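/- Let $\Lambda$ be an artin algebra, i.e. a ring that is an algebra over a commutative artinian ring $R$ and finitely generated as an $R$-module. Let $\Lambda\text{-Mod}$ be the category of left $\Lambda$-modules and $\Lambda\text{-mod}$ the abelian category of finitely generated left $\Lambda$-modules. Let $n \ge 2$ and let $\mathcal{M}$ be an $n$-cluster tilting subcategory of $\Lambda\text{-mod}$, that is, a full subcategory such that: (1) every object of $\Lambda\text{-mod}$ is a quotient of an object of $\mathcal{M}$ and a subobject of an object of $\mathcal{M}$; (2) $\mathcal{M}$ is functorially finite in $\Lambda\text{-mod}$: for every $A \in \Lambda\text{-mod}$ there are a morphism $M \to A$ with $M \in \mathcal{M}$ through which every morphism from an object of $\mathcal{M}$ to $A$ factors, and a morphism $A \to M'$ with $M' \in \mathcal{M}$ through which every morphism from $A$ to an object of $\mathcal{M}$ factors; (3) for every $X \in \Lambda\text{-mod}$ one has $X \in \mathcal{M}$ if and only if $\operatorname{Ext}^i_{\Lambda\text{-mod}}(M,X)=0$ for all $M \in \mathcal{M}$ and all $0<i<n$, and also $X \in \mathcal{M}$ if and only if $\operatorname{Ext}^i_{\Lambda\text{-mod}}(X,M)=0$ for all $M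 \in \mathcal{M}$ and all $0<i<n$. Let $\varinjlim \mathcal{M}$ be the full subcategory of $\Lambda\text{-Mod}$ whose objects are the modules that are filtered colimits in $\Lambda\text{-Mod}$ of (small) filtered systems of objects of $\mathcal{M}$. Then $$\{\, X \in \Lambda\text{-Mod} \mid \operatorname{Ext}^i_\Lambda(M,X)=0 \text{ for all } M \in \mathcal{M} \text{ and all } 0<i<n \,\} = \varinjlim \mathcal{M}.$$ -/

import Mathlib

open CategoryTheory Limits

universe w v u

/-! ### Artin algebras -/

/-- A ring `Λ` is an artin algebra if it is an algebra over a commutative artinian ring `R`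
and is finitely generated as an `R`-module. Since `R` may be replaced by its image in `Λ`,
taking `R` in the universe of `Λ` is no restriction. -/
class IsArtinAlgebra (Λ : Type u) [Ring Λ] : Prop where
  exists_base : ∃ (R : Type u) (_ : CommRing R) (_ : IsArtinianRing R) (_ : Algebra R Λ),
    Module.Finite R Λ

/-- An artin algebra is left noetherian, so that its finitely generated left modules form an
abelian category. -/
instance IsArtinAlgebra.isNoetherianRing (Λ : Type u) [Ring Λ] [IsArtinAlgebra Λ] :
    IsNoetherianRing Λ := by
  obtain ⟨R, _, _, _, _⟩ := IsArtinAlgebra.exists_base (Λ := Λ)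
  exact isNoetherian_of_tower R inferInstance

/-- The category of finitely generated modules over a noetherian ring has enough projectives. -/
instance FGModuleCat.enoughProjectives (Λ : Type u) [Ring Λ] [IsNoetherianRing Λ] :
    EnoughProjectives (FGModuleCat.{u} Λ) where
  presentation X := by
    obtain ⟨k, f, hf⟩ := Module.Finite.exists_fin' Λ X
    let F := forget₂ (FGModuleCat.{u} Λ) (ModuleCat.{u} Λ)
    let P : FGModuleCat.{u} Λ := FGModuleCat.of Λ (Fin k → Λ)
    have hP : Projective (F.obj P) :=
      ModuleCat.projective_of_free (M := ModuleCat.of Λ (Fin k → Λ)) (Pi.basisFun Λ (Fin k))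
    have hf' : Epi (F.map (FGModuleCat.ofHom f)) := (ModuleCat.epi_iff_surjective _).2 hf
    exact ⟨{ p := P
             projective := F.projective_of_map_projective hP
             f := FGModuleCat.ofHom f
             epi := F.epi_of_epi_map hf' }⟩

/-- `Ext`-groups in the category of finitely generated modules over a noetherian ring. -/
instance FGModuleCat.hasExt (Λ : Type u) [Ring Λ] [IsNoetherianRing Λ] :
    HasExt.{u} (FGModuleCat.{u} Λ) :=
  hasExt_of_enoughProjectives.{u} (FGModuleCat.{u} Λ)

/-! ### `n`-cluster tilting subcategories

A full subcategory of a category `A` is given by the property of belonging to it. -/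

namespace HigherAuslander

variable {A : Type u} [Category.{v} A]

/-- Every object of `A` is a quotient of an object of `M`. -/
def IsGenerating (M : ObjectProperty A) : Prop :=
  ∀ X : A, ∃ (Y : A) (f : Y ⟶ X), M Y ∧ Epi f

/-- Every object of `A` is a subobject of an object of `M`. -/
def IsCogenerating (M : ObjectProperty A) : Prop :=
  ∀ X : A, ∃ (Y : A) (f : X ⟶ Y), M Y ∧ Mono f

/-- `θ : Y ⟶ X` is a right `M`-approximation of `X`. -/
def IsRightApproximation (M : ObjectProperty A) {Y X : A} (θ : Y ⟶ X) : Prop :=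
  M Y ∧ ∀ (Z : A) (g : Z ⟶ X), M Z → ∃ h : Z ⟶ Y, h ≫ θ = g

/-- `θ : X ⟶ Y` is a left `M`-approximation of `X`. -/
def IsLeftApproximation (M : ObjectProperty A) {X Y : A} (θ : X ⟶ Y) : Prop :=
  M Y ∧ ∀ (Z : A) (g : X ⟶ Z), M Z → ∃ h : Y ⟶ Z, θ ≫ h = g

/-- Every object of `A` has a right `M`-approximation. -/
def IsContravariantlyFinite (M : ObjectProperty A) : Prop :=
  ∀ X : A, ∃ (Y : A) (θ : Y ⟶ X), IsRightApproximation M θ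

/-- Every object of `A` has a left `M`-approximation. -/
def IsCovariantlyFinite (M : ObjectProperty A) : Prop :=
  ∀ X : A, ∃ (Y : A) (θ : X ⟶ Y), IsLeftApproximation M θ

/-- `M` is functorially finite in `A`. -/
def IsFunctoriallyFinite (M : ObjectProperty A) : Prop :=
  IsContravariantlyFinite M ∧ IsCovariantlyFinite M

variable [Abelian A] [HasExt.{w} A]

/-- The objects `Y` with `Ext^i(M, Y) = 0` for all `0 < i < n`. -/
def rightPerp (M : ObjectProperty A) (n : ℕ) : ObjectProperty A :=
  fun Y => ∀ X : A, M X → ∀ i : ℕ, 0 < i → i < n → Subsingleton (Abelian.Ext.{w} X Y i)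

/-- The objects `X` with `Ext^i(X, M) = 0` for all `0 < i < n`. -/
def leftPerp (M : ObjectProperty A) (n : ℕ) : ObjectProperty A :=
  fun X => ∀ Y : A, M Y → ∀ i : ℕ, 0 < i → i < n → Subsingleton (Abelian.Ext.{w} X Y i)

/-- `M` is an `n`-cluster tilting subcategory of the abelian category `A`. -/
structure IsClusterTilting (M : ObjectProperty A) (n : ℕ) : Prop where
  generating : IsGenerating M
  cogenerating : IsCogenerating M
  functoriallyFinite : IsFunctoriallyFinite M
  rightPerp_eq : rightPerp.{w} M n = M
  leftPerp_eq : leftPerp.{w} M n = M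

end HigherAuslander

/-- A full subcategory of the finitely generated left `Λ`-modules, regarded as a full subcategory
(closed under isomorphism) of the category of all left `Λ`-modules. -/
def FGModuleCat.inModuleCat {Λ : Type u} [Ring Λ] (M : ObjectProperty (FGModuleCat.{u} Λ)) :
    ObjectProperty (ModuleCat.{u} Λ) :=
  M.map (ModuleCat.isFG.{u} Λ).ι

/-- The filtered colimits, in the category of all left `Λ`-modules, of objects of `M`. -/
def FGModuleCat.filteredColimits {Λ : Type u} [Ring Λ] (M : ObjectProperty (FGModuleCat.{u} Λ)) :
    ObjectProperty (ModuleCat.{u} Λ) :=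
  ObjectProperty.ind.{u} (FGModuleCat.inModuleCat M)

/-! Both sides describe the modules `X` such that every map `F ⟶ X` with `F` finitely generated
factors through an object of `M`. For filtered colimits this is the usual criterion, since over a
noetherian ring finitely generated and finitely presentable modules coincide
(`filteredColimits_iff_exists_factorization`). If `Ext` from `M` to `X` vanishes, embed `F` by a
left approximation `F ⟶ Z` with cokernel `C`; maps to `X` extend to `Z` once `Ext^1(C, X) = 0`. Each
further cokernel gains one vanishing `Ext` into `M`, so after `n - 1` cokernels one lies in `M`, and
dimension shifting brings the vanishing back to `C`. Conversely, a map to `X` from the syzygy of `F`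
factors through some `Z` in `M`, and extends to the projective cover term when `Ext^1(F, Z) = 0`; so
vanishing of `Ext` from `F` into `M` passes to `X`. -/

/-! ### Finitely presentable modules -/

namespace ModuleCat

variable (Λ : Type u) [Ring Λ]

/-- The forgetful functor on modules is corepresented by the ring itself. -/
noncomputable def coyonedaSelfIso :
    coyoneda.obj (Opposite.op (ModuleCat.of Λ Λ)) ≅ forget (ModuleCat.{u} Λ) :=
  NatIso.ofComponents
    (fun X => (ModuleCat.homEquiv.trans
      (LinearMap.ringLmapEquivSelf Λ ℕ X).toEquiv).toIso)
    (fun f => by ext; rfl)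

instance isFinitelyPresentable_self : IsFinitelyPresentable.{u} (ModuleCat.of Λ Λ) := by
  rw [isFinitelyPresentable_iff_preservesFilteredColimits]
  constructor
  intro J _ _
  exact preservesColimitsOfShape_of_natIso (coyonedaSelfIso Λ).symm

lemma isStrongGenerator_self :
    (ObjectProperty.singleton (ModuleCat.of Λ Λ)).IsStrongGenerator := by
  rw [ObjectProperty.isStrongGenerator_iff]
  refine ⟨?_, fun X Y i _ hi => ?_⟩
  · intro X Y f g h
    ext x
    have := congr($(h _ ⟨PUnit.unit⟩ (ModuleCat.ofHom (LinearMap.toSpanSingleton Λ X x))).hom (1 : Λ))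
    simpa using this
  · have : Epi i := by
      rw [ModuleCat.epi_iff_surjective]
      intro y
      obtain ⟨f, hf⟩ := hi _ ⟨PUnit.unit⟩ (ModuleCat.ofHom (LinearMap.toSpanSingleton Λ Y y))
      exact ⟨f.hom (1 : Λ), by simpa using congr($(hf).hom (1 : Λ))⟩
    exact isIso_of_mono_of_epi i

attribute [local instance] Cardinal.fact_isRegular_aleph0

instance isLocallyFinitelyPresentable :
    IsLocallyFinitelyPresentable.{u} (ModuleCat.{u} Λ) := by
  refine (IsCardinalLocallyPresentable.iff_exists_isStrongGenerator _ _).2 ⟨_, inferInstance, isStrongGenerator_self Λ, ?_⟩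
  rw [ObjectProperty.singleton_le_iff]
  exact isFinitelyPresentable_self Λ

instance isFG_isClosedUnderIsomorphisms : (isFG.{u} Λ).IsClosedUnderIsomorphisms where
  of_iso e h := by
    rw [isFG_iff] at h ⊢
    exact Module.Finite.equiv e.toLinearEquiv

/-- The images of the legs span the colimit, because the quotient map by their sum kills every leg.
-/
lemma isFG_isClosedUnderColimitsOfShape (J : Type u) [SmallCategory J] [Finite J] :
    (isFG.{u} Λ).IsClosedUnderColimitsOfShape J where
  colimitsOfShape_le := by
    rintro X ⟨p⟩
    have hfin (j : J) : Module.Finite Λ (p.diag.obj j) := p.prop_diag_obj j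
    let S : Submodule Λ X := ⨆ j, LinearMap.range (p.ι.app j).hom
    have hS : S = ⊤ := by
      have h : ModuleCat.ofHom S.mkQ = 0 := p.isColimit.hom_ext fun j => by
        ext x
        exact (Submodule.Quotient.mk_eq_zero S).2
          (Submodule.mem_iSup_of_mem j (LinearMap.mem_range_self (p.ι.app j).hom x))
      rw [← Submodule.ker_mkQ S, LinearMap.ker_eq_top]
      exact congr($(h).hom)
    refine ⟨?_⟩
    rw [← hS]
    exact Submodule.fg_iSup _ fun j => Module.Finite.iff_fg.1 (Module.Finite.range (p.ι.app j).hom)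

/-- Finitely presentable modules are the closure of `Λ` under finite colimits, which preserve finite
generation. -/
lemma isFinitelyPresentable_le_isFG :
    ObjectProperty.isFinitelyPresentable.{u} (ModuleCat.{u} Λ) ≤ isFG.{u} Λ := by
  rw [ObjectProperty.isFinitelyPresentable_eq_isCardinalPresentable,
    IsStrongGenerator.colimitsCardinalClosure_eq_isCardinalPresentable
      (isStrongGenerator_self Λ) (by
        rw [ObjectProperty.singleton_le_iff]; exact isFinitelyPresentable_self Λ)]
  refine ObjectProperty.colimitsCardinalClosure_le _ _ (fun J _ hJ => ?_) ?_
  · have := (hasCardinalLT_aleph0_iff _).1 (hasCardinalLT_of_hasCardinalLT_arrow hJ)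
    exact isFG_isClosedUnderColimitsOfShape Λ J
  · rw [ObjectProperty.singleton_le_iff, isFG_iff]
    exact Module.Finite.self Λ

lemma isFinitelyPresentable_free (k : ℕ) :
    IsFinitelyPresentable.{u} (ModuleCat.of Λ (Fin k → Λ)) := by
  have := isClosedUnderColimitsOfShape_isCardinalPresentable (ModuleCat.{u} Λ)
    (κ := Cardinal.aleph0.{u}) (J := Discrete (Fin k)) (by
      rw [hasCardinalLT_aleph0_iff]; infer_instance)
  have e : (⨁ fun _ : Fin k => ModuleCat.of Λ Λ) ≅ ModuleCat.of Λ (Fin k → Λ) :=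
    ModuleCat.biproductIsoPi _
  refine (isCardinalPresentable (ModuleCat.{u} Λ) Cardinal.aleph0.{u}).prop_of_iso e ?_
  exact ObjectProperty.prop_of_isColimit _ (biproduct.isColimit _)
    (fun _ => isFinitelyPresentable_self Λ)

/-- Over a noetherian ring, finitely generated modules are finitely presentable objects of the
category of modules. -/
lemma isFG_le_isFinitelyPresentable [IsNoetherianRing Λ] :
    isFG.{u} Λ ≤ ObjectProperty.isFinitelyPresentable.{u} (ModuleCat.{u} Λ) := by
  intro N hN
  rw [isFG_iff] at hN
  obtain ⟨k, f, hf⟩ := Module.Finite.exists_fin' Λ N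
  -- Noetherianity makes the kernel finitely generated, giving a finite presentation.
  obtain ⟨l, g, hg⟩ := Module.Finite.exists_fin' Λ (LinearMap.ker f)
  have hex : Function.Exact ((LinearMap.ker f).subtype ∘ₗ g) f := by
    rw [LinearMap.exact_iff, LinearMap.range_comp, LinearMap.range_eq_top.2 hg]
    simp
  have := isClosedUnderColimitsOfShape_isCardinalPresentable (ModuleCat.{u} Λ)
    (κ := Cardinal.aleph0.{u}) (J := WalkingParallelPair) (by
      rw [hasCardinalLT_aleph0_iff]; infer_instance)
  refine ObjectProperty.prop_of_isColimit (isCardinalPresentable _ Cardinal.aleph0.{u})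
    (isColimitCokernelCofork (ModuleCat.ofHom ((LinearMap.ker f).subtype ∘ₗ g))
      (ModuleCat.ofHom f) hex hf) ?_
  rintro (_ | _)
  · exact isFinitelyPresentable_free Λ l
  · exact isFinitelyPresentable_free Λ k

end ModuleCat

/-! ### Dimension shifting for `Ext` -/

namespace CategoryTheory.ShortComplex.ShortExact

open Abelian

variable {C : Type u} [Category.{v} C] [Abelian C] [HasExt.{w} C] {S : ShortComplex C}

lemma subsingleton_ext_X₁ (hS : S.ShortExact) {Y : C} {n : ℕ}
    (h₂ : Subsingleton (Ext.{w} S.X₂ Y n)) (h₃ : Subsingleton (Ext.{w} S.X₃ Y (n + 1))) :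
    Subsingleton (Ext.{w} S.X₁ Y n) := by
  refine subsingleton_of_forall_eq 0 fun x => ?_
  obtain ⟨y, rfl⟩ := Ext.contravariant_sequence_exact₁ hS Y x (Nat.add_comm 1 n)
    (Subsingleton.elim _ _)
  rw [Subsingleton.elim y 0, Ext.comp_zero]

lemma subsingleton_ext_X₃ (hS : S.ShortExact) {Y : C} {n : ℕ}
    (h₁ : Subsingleton (Ext.{w} S.X₁ Y n)) (h₂ : Subsingleton (Ext.{w} S.X₂ Y (n + 1))) :
    Subsingleton (Ext.{w} S.X₃ Y (n + 1)) := by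
  refine subsingleton_of_forall_eq 0 fun x => ?_
  obtain ⟨y, rfl⟩ := Ext.contravariant_sequence_exact₃ hS Y x (Subsingleton.elim _ _)
    (Nat.add_comm 1 n)
  rw [Subsingleton.elim y 0, Ext.comp_zero]

lemma exists_extension (hS : S.ShortExact) {Y : C}
    (h₃ : Subsingleton (Ext.{w} S.X₃ Y 1)) (f : S.X₁ ⟶ Y) : ∃ g : S.X₂ ⟶ Y, S.f ≫ g = f := by
  obtain ⟨y, hy⟩ := Ext.contravariant_sequence_exact₁ hS Y (Ext.mk₀ f) (Nat.add_comm 1 0)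
    (Subsingleton.elim _ _)
  obtain ⟨g, rfl⟩ := (Ext.mk₀_bijective _ _).2 y
  rw [Ext.mk₀_comp_mk₀] at hy
  exact ⟨g, (Ext.mk₀_bijective _ _).1 hy⟩

/-- If every map extends along `S.f`, the connecting map into `Ext^1(S.X₃, Y)` is zero. -/
lemma subsingleton_ext_X₃_one (hS : S.ShortExact) {Y : C}
    (h : ∀ f : S.X₁ ⟶ Y, ∃ g : S.X₂ ⟶ Y, S.f ≫ g = f)
    (h₂ : Subsingleton (Ext.{w} S.X₂ Y 1)) :
    Subsingleton (Ext.{w} S.X₃ Y 1) := by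
  refine subsingleton_of_forall_eq 0 fun x => ?_
  obtain ⟨y, rfl⟩ := Ext.contravariant_sequence_exact₃ hS Y x (Subsingleton.elim _ _)
    (Nat.add_comm 1 0)
  obtain ⟨f, rfl⟩ := (Ext.mk₀_bijective _ _).2 y
  obtain ⟨g, rfl⟩ := h f
  rw [← Ext.mk₀_comp_mk₀, ← Ext.comp_assoc (a₁₂ := 1) (a₂₃ := 0) _ _ _ rfl rfl rfl,
    hS.extClass_comp, Ext.zero_comp]

end CategoryTheory.ShortComplex.ShortExact

lemma CategoryTheory.Abelian.Ext.subsingleton_of_iso {C : Type u} [Category.{v} C] [Abelian C]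
    [HasExt.{w} C] {X X' : C} (e : X ≅ X') {Y : C} {n : ℕ} (h : Subsingleton (Ext.{w} X Y n)) :
    Subsingleton (Ext.{w} X' Y n) := by
  refine subsingleton_of_forall_eq 0 fun x => ?_
  rw [← Ext.mk₀_id_comp x, ← e.inv_hom_id, ← Ext.mk₀_comp_mk₀_assoc,
    Subsingleton.elim ((Ext.mk₀ e.hom).comp x (zero_add n)) 0, Ext.comp_zero]

/-! ### Cluster tilting subcategories and exact functors -/

namespace HigherAuslander

open Abelian

variable {A : Type*} [Category* A]

/-- If `M` is cogenerating, every left `M`-approximation is a monomorphism. -/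
lemma IsLeftApproximation.mono {M : ObjectProperty A} (hM : IsCogenerating M) {X Y : A}
    {θ : X ⟶ Y} (hθ : IsLeftApproximation M θ) : Mono θ := by
  obtain ⟨Z, f, hZ, _⟩ := hM X
  obtain ⟨h, rfl⟩ := hθ.2 Z f hZ
  exact mono_of_mono θ h

variable [Abelian A] {B : Type*} [Category* B] [Abelian B]

/-- Every object is the kernel of a left `M`-approximation whose cokernel has one more vanishing
`Ext`-group into `M`. -/
lemma IsClusterTilting.exists_shortExact [HasExt.{w} A] {M : ObjectProperty A} {n : ℕ}
    (hM : IsClusterTilting.{w} M n) (F : A) {j : ℕ} (hj : j + 1 < n)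
    (hF : ∀ Y, M Y → ∀ i, 0 < i → i ≤ j → Subsingleton (Ext.{w} F Y i)) :
    ∃ (Z C : A) (f : F ⟶ Z) (g : Z ⟶ C) (h : f ≫ g = 0), (ShortComplex.mk f g h).ShortExact ∧
      M Z ∧ ∀ Y, M Y → ∀ i, 0 < i → i ≤ j + 1 → Subsingleton (Ext.{w} C Y i) := by
  obtain ⟨Z, θ, hθ⟩ := hM.functoriallyFinite.2 F
  have := hθ.mono hM.cogenerating
  have hS : (ShortComplex.mk θ (cokernel.π θ) (cokernel.condition θ)).ShortExact :=
    { exact := ShortComplex.exact_cokernel θ }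
  have hZ : leftPerp.{w} M n Z := by rw [hM.leftPerp_eq]; exact hθ.1
  refine ⟨Z, cokernel θ, θ, cokernel.π θ, cokernel.condition θ, hS, hθ.1, fun Y hY i hi hij => ?_⟩
  obtain _ | _ | i := i
  · omega
  · exact hS.subsingleton_ext_X₃_one (fun f => hθ.2 Y f hY) (hZ Y hY 1 one_pos (by omega))
  · exact hS.subsingleton_ext_X₃ (hF Y hY (i + 1) (by omega) (by omega))
      (hZ Y hY (i + 2) (by omega) (by omega))

variable (G : A ⥤ B) [G.Additive] [PreservesFiniteLimits G] [PreservesFiniteColimits G]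

/-- Here `d = n - 1 - j` counts the approximations still needed to reach `M`. `Ext^i(G F, X)` lies
between `Ext^i(G Z, X)` and `Ext^(i+1)(G C, X)`, both zero. -/
lemma IsClusterTilting.subsingleton_ext_map [HasExt.{w} A] [HasExt.{u} B]
    {M : ObjectProperty A} {n : ℕ} (hM : IsClusterTilting.{w} M n) {X : B}
    (hX : rightPerp.{u} (M.map G) n X) (d : ℕ) :
    ∀ {j : ℕ}, j + d + 1 = n → ∀ {F : A},
      (∀ Y, M Y → ∀ i, 0 < i → i ≤ j → Subsingleton (Ext.{w} F Y i)) →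
      ∀ i, 0 < i → i ≤ j → Subsingleton (Ext.{u} (G.obj F) X i) := by
  induction d with
  | zero =>
    intro j hj F hF i hi hij
    have hMF : M F := by
      rw [← hM.leftPerp_eq]
      exact fun Y hY i hi hin => hF Y hY i hi (by omega)
    exact hX _ (M.prop_map_obj G hMF) i hi (by omega)
  | succ d ih =>
    intro j hj F hF i hi hij
    obtain ⟨Z, C, f, g, h, hS, hZ, hC⟩ := hM.exists_shortExact F (by omega) hF
    exact (hS.map_of_exact G).subsingleton_ext_X₁ (hX _ (M.prop_map_obj G hZ) i hi (by omega))
      (ih (by omega) hC (i + 1) (by omega) (by omega))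

/-- If `Ext^i(G M, X) = 0` for all `0 < i < n`, then every morphism from the image of the exact
functor `G` to `X` factors through the image of `M`. -/
lemma IsClusterTilting.exists_factorization [HasExt.{w} A] [HasExt.{u} B]
    {M : ObjectProperty A} {n : ℕ} (hn : 2 ≤ n) (hM : IsClusterTilting.{w} M n) {X : B}
    (hX : rightPerp.{u} (M.map G) n X) {F : A} (a : G.obj F ⟶ X) :
    ∃ (Z : A) (f : F ⟶ Z) (b : G.obj Z ⟶ X), M Z ∧ G.map f ≫ b = a := by
  obtain ⟨Z, C, f, g, h, hS, hZ, hC⟩ := hM.exists_shortExact F (j := 0) (by omega)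
    (fun _ _ i hi hi' => by omega)
  obtain ⟨b, hb⟩ := (hS.map_of_exact G).exists_extension
    (hM.subsingleton_ext_map G hX (n - 2) (by omega) hC 1 one_pos le_rfl) a
  exact ⟨Z, f, b, hZ, hb⟩

/-- If every morphism from the image of `G` to `X` factors through the image of `M`, then
`Ext^i(F, M) = 0` implies `Ext^i(G F, X) = 0` for `0 < i`. -/
lemma subsingleton_ext_map_of_factorization [EnoughProjectives A]
    [G.PreservesProjectiveObjects] [HasExt.{w} A] [HasExt.{u} B] {M : ObjectProperty A} {X : B}
    (hX : ∀ (F : A) (a : G.obj F ⟶ X),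
      ∃ (Z : A) (f : F ⟶ Z) (b : G.obj Z ⟶ X), M Z ∧ G.map f ≫ b = a) (i : ℕ) :
    ∀ {F : A}, (∀ Y, M Y → Subsingleton (Ext.{w} F Y (i + 1))) →
      Subsingleton (Ext.{u} (G.obj F) X (i + 1)) := by
  induction i with
  | zero =>
    intro F hF
    have hS : (ShortComplex.mk (kernel.ι (Projective.π F)) (Projective.π F)
        (kernel.condition _)).ShortExact := { exact := ShortComplex.exact_kernel _ }
    refine (hS.map_of_exact G).subsingleton_ext_X₃_one (fun a => ?_)
      (Ext.subsingleton_of_projective (G.obj (Projective.over F)) X 0)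
    obtain ⟨Z, f, b, hZ, rfl⟩ := hX _ a
    -- The extension is made in `A`, with target in `M`, where the hypothesis on `F` applies.
    obtain ⟨g, rfl⟩ := hS.exists_extension (hF Z hZ) f
    exact ⟨G.map g ≫ b, by rw [G.map_comp, Category.assoc]; rfl⟩
  | succ i ih =>
    intro F hF
    have hS : (ShortComplex.mk (kernel.ι (Projective.π F)) (Projective.π F)
        (kernel.condition _)).ShortExact := { exact := ShortComplex.exact_kernel _ }
    exact (hS.map_of_exact G).subsingleton_ext_X₃
      (ih fun Y hY => hS.subsingleton_ext_X₁
        (Ext.subsingleton_of_projective (Projective.over F) Y i) (hF Y hY))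
      (Ext.subsingleton_of_projective (G.obj (Projective.over F)) X (i + 1))

end HigherAuslander

/-! ### Finitely generated modules inside all modules -/

namespace FGModuleCat

variable (Λ : Type u) [Ring Λ]

/-- A projective finitely generated module is a retract of a free module of finite rank. -/
instance : (ModuleCat.isFG.{u} Λ).ι.PreservesProjectiveObjects where
  projective_obj {P} hP := by
    obtain ⟨k, f, hf⟩ := Module.Finite.exists_fin' Λ P
    let g : FGModuleCat.of Λ (Fin k → Λ) ⟶ P := FGModuleCat.ofHom f
    have : Epi ((ModuleCat.isFG.{u} Λ).ι.map g) := (ModuleCat.epi_iff_surjective _).2 hf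
    have : Epi g := (ModuleCat.isFG.{u} Λ).ι.epi_of_epi_map this
    have : Projective ((ModuleCat.isFG.{u} Λ).ι.obj (FGModuleCat.of Λ (Fin k → Λ))) :=
      ModuleCat.projective_of_free (M := ModuleCat.of Λ (Fin k → Λ)) (Pi.basisFun Λ (Fin k))
    let r : Retract P (FGModuleCat.of Λ (Fin k → Λ)) :=
      { i := Projective.factorThru (𝟙 P) g, r := g, retract := Projective.factorThru_comp _ _ }
    exact (r.map (ModuleCat.isFG.{u} Λ).ι).projective

instance : PreservesFiniteColimits (ModuleCat.isFG.{u} Λ).ι :=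
  inferInstanceAs (PreservesFiniteColimits (forget₂ (FGModuleCat.{u} Λ) (ModuleCat.{u} Λ)))

instance [IsNoetherianRing Λ] : PreservesFiniteLimits (ModuleCat.isFG.{u} Λ).ι :=
  inferInstanceAs (PreservesFiniteLimits (forget₂ (FGModuleCat.{u} Λ) (ModuleCat.{u} Λ)))

/-- A module is a filtered colimit of objects of `M` if and only if every morphism to it from a
finitely generated module factors through an object of `M`. -/
lemma filteredColimits_iff_exists_factorization {Λ : Type u} [Ring Λ] [IsNoetherianRing Λ]
    (M : ObjectProperty (FGModuleCat.{u} Λ)) (X : ModuleCat.{u} Λ) :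
    filteredColimits M X ↔ ∀ (F : FGModuleCat.{u} Λ) (a : (ModuleCat.isFG.{u} Λ).ι.obj F ⟶ X),
      ∃ (Z : FGModuleCat.{u} Λ) (f : F ⟶ Z) (b : (ModuleCat.isFG.{u} Λ).ι.obj Z ⟶ X),
        M Z ∧ (ModuleCat.isFG.{u} Λ).ι.map f ≫ b = a := by
  have hM : inModuleCat M ≤ ObjectProperty.isFinitelyPresentable.{u} (ModuleCat.{u} Λ) :=
    fun Y ⟨Z, _, ⟨e⟩⟩ => ModuleCat.isFG_le_isFinitelyPresentable Λ _
      ((ModuleCat.isFG.{u} Λ).prop_of_iso e Z.property)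
  rw [filteredColimits, ObjectProperty.ind_iff_exists hM]
  refine ⟨fun h F a => ?_, fun h F a hF => ?_⟩
  · have : IsFinitelyPresentable.{u} ((ModuleCat.isFG.{u} Λ).ι.obj F) :=
      ModuleCat.isFG_le_isFinitelyPresentable Λ _ F.property
    obtain ⟨W, s, t, rfl, Z, hZ, ⟨e⟩⟩ := h a
    exact ⟨Z, (ModuleCat.isFG.{u} Λ).fullyFaithfulι.preimage (s ≫ e.inv), e.hom ≫ t, hZ, by simp⟩
  · obtain ⟨Z, f, b, hZ, hb⟩ := h ⟨F, ModuleCat.isFinitelyPresentable_le_isFG Λ _ hF⟩ a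
    exact ⟨_, _, b, hb, M.prop_map_obj _ hZ⟩

end FGModuleCat

theorem corollary2p1p1 (Λ : Type u) [Ring Λ] [IsArtinAlgebra Λ] (n : ℕ) (hn : 2 ≤ n)
    (M : ObjectProperty (FGModuleCat.{u} Λ))
    (hM : HigherAuslander.IsClusterTilting.{u} M n) :
    HigherAuslander.rightPerp.{u} (FGModuleCat.inModuleCat M) n =
      FGModuleCat.filteredColimits M := by
  ext X
  rw [FGModuleCat.filteredColimits_iff_exists_factorization]
  refine ⟨fun hX F a => hM.exists_factorization (ModuleCat.isFG.{u} Λ).ι hn hX a, ?_⟩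
  rintro hX Y ⟨Z, hZ, ⟨e⟩⟩ i hi hin
  obtain ⟨i, rfl⟩ := Nat.exists_eq_succ_of_ne_zero hi.ne'
  refine Abelian.Ext.subsingleton_of_iso e
    (HigherAuslander.subsingleton_ext_map_of_factorization _ hX i fun W hW => ?_)
  rw [← hM.leftPerp_eq] at hZ
  exact hZ W hW _ hi hin
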